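/- Let $A_2=\mathbb{C}[t_1,t_2]$, $\partial_i=\partial/\partial t_i$, and let $\bar S_2$ be the Lie algebra of all derivations $D=p_1\partial_1+p_2\partial_2$ of $A_2$ ($p_1,p_2\in A_2$) with constant divergence, i.e. $\partial_1(p_1)+\partial_2(p_2)\in\mathbb{C}$. Let $\Delta_2=\mathrm{span}\{\partial_1,\partial_2\}\subset\bar S_2$, and let $\widetilde S_2=\bar S_2\ltimes A_2$ be the semidirect product, where $A_2$ is an abelian ideal on which $\bar S_2$ acts by derivations. An $(A_2,\bar S_2)$-module is an $\widetilde S_2$-module $M$ on which $A_2$ acts associatively: $f(gv)=(fg)v$ and $1v=v$ for all $f,g\in A_2$, $v\in M$. It is a Whittaker module if $\Delta_2$ acts locally finitely on it. For $\mathbf a=(a_1,a_2)\in\mathbb{C}^2$ let $\phi_{\mathbf a}:\Delta_2\to\mathbb{C}$ be the homomorphism with $\phi_{\mathbf a}(\partial_i)=a_i$; a Whittaker module $M$ is of type $\phi_{\mathbf a}$ if for every $v\in M$ and $x\in\Delta_2$ there is a $k$ with $(x-\phi_{\mathbf a}(x))^kv=0$. Put $\mathrm{Wh}_{\mathbf a}(M)=\{v\in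 M : xv=\phi_{\mathbf a}(x)v \text{ for all } x\in\Delta_2\}$. For a $\mathfrak{gl}_2(\mathbb{C})$-module $V$, let $T(A_2^{\mathbf a},V)$ be the $(A_2,\bar S_2)$-module with underlying space $A_2\otimes V$ and action $$D(p\otimes v)=\big(D(p)+(a_1p_1+a_2p_2)p\big)\otimes v+\sum_{i,j=1}^{2}\partial_j(p_i)\,p\otimes E_{ji}v,\qquad f(p\otimes v)=(fp)\otimes v,$$ for $D=p_1\partial_1+p_2\partial_2\in\bar S_2$, $f,p\in A_2$, $v\in V$, where $E_{ji}$ are the matrix units. If $\mathbf a\in\mathbb{C}^2$ and $M$ is a simple Whittaker $(A_2,\bar S_2)$-module of type $\phi_{\mathbf a}$ with $\dim\mathrm{Wh}_{\mathbf a}(M)<\infty$, then there is a simple finite-dimensional $\mathfrak{gl}_2(\mathbb{C})$-module $V$ such that $M\cong T(A_2^{\mathbf a},V)$ as $(A_2,\bar S_2)$-modules. -/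

import Mathlib

open scoped TensorProduct

universe u

/- The commutator bracket on an associative ring. It is used for `gl₂` and endomorphism algebras;
on the commutative ring `ℂ[t₁, t₂]` and on `ℂ` it is the zero bracket. -/
attribute [local instance] LieRing.ofAssociativeRing

noncomputable section

namespace CartanS

/-! ### The Lie algebras -/

/-- The polynomial algebra `A₂ = ℂ[t₁, t₂]` (indices `0, 1 : Fin 2` stand for `1, 2`). -/
abbrev A₂ : Type := MvPolynomial (Fin 2) ℂ

/-- The Witt algebra `W₂` of all derivations of `A₂`, with the commutator bracket. A derivation
`D` is the vector field `∑ i, D tᵢ • ∂ᵢ`. -/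
abbrev W₂ : Type := Derivation ℂ A₂ A₂

/-- The Lie algebra `gl₂` of complex `2 × 2` matrices with the commutator bracket. -/
abbrev gl₂ : Type := Matrix (Fin 2) (Fin 2) ℂ

/-- The divergence `∑ i, ∂ᵢ (pᵢ)` of the vector field `D = ∑ i, pᵢ ∂ᵢ`, where `pᵢ = D tᵢ`. -/
def divergence : W₂ →ₗ[ℂ] A₂ where
  toFun D := ∑ i, MvPolynomial.pderiv i (D (MvPolynomial.X i))
  map_add' D E := by simp [Finset.sum_add_distrib]
  map_smul' c D := by simp

theorem apply_eq_sum (D : W₂) (f : A₂) :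
    D f = ∑ k, D (MvPolynomial.X k) * MvPolynomial.pderiv k f := by
  have h : D = ∑ k, D (MvPolynomial.X k) • (MvPolynomial.pderiv k : W₂) := by
    ext i
    simp [MvPolynomial.pderiv_X, Pi.single_apply, Fin.sum_univ_two]
    fin_cases i <;> simp
  conv_lhs => rw [h]
  simp [Fin.sum_univ_two]

theorem pderiv_comm (i j : Fin 2) (f : A₂) :
    MvPolynomial.pderiv i (MvPolynomial.pderiv j f)
      = MvPolynomial.pderiv j (MvPolynomial.pderiv i f) := by
  have h : ⁅(MvPolynomial.pderiv i : W₂), (MvPolynomial.pderiv j : W₂)⁆ = 0 := by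
    ext k
    simp [Derivation.commutator_apply, MvPolynomial.pderiv_X, Pi.single_apply, apply_ite]
  have := congrArg (fun D : W₂ => D f) h
  simpa [Derivation.commutator_apply, sub_eq_zero] using this

theorem pderiv_apply (j : Fin 2) (D : W₂) (f : A₂) :
    MvPolynomial.pderiv j (D f) = D (MvPolynomial.pderiv j f)
      + ∑ k, MvPolynomial.pderiv j (D (MvPolynomial.X k)) * MvPolynomial.pderiv k f := by
  rw [apply_eq_sum D f, apply_eq_sum D (MvPolynomial.pderiv j f)]
  simp only [Fin.sum_univ_two, map_add, Derivation.leibniz, smul_eq_mul, pderiv_comm j]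
  ring

theorem divergence_lie (D E : W₂) :
    divergence ⁅D, E⁆ = D (divergence E) - E (divergence D) := by
  simp only [divergence, LinearMap.coe_mk, AddHom.coe_mk, Derivation.commutator_apply, map_sub]
  simp only [pderiv_apply _ D (E _), pderiv_apply _ E (D _), Fin.sum_univ_two, map_add]
  ring

/-- The Lie algebra `S̄₂` of polynomial vector fields on `ℂ²` with constant divergence. -/
def SBar : LieSubalgebra ℂ W₂ where
  carrier := {D | ∃ c : ℂ, divergence D = MvPolynomial.C c}
  add_mem' := by
    rintro D E ⟨c, hc⟩ ⟨d, hd⟩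
    exact ⟨c + d, by simp [hc, hd]⟩
  zero_mem' := ⟨0, by simp⟩
  smul_mem' := by
    rintro r D ⟨c, hc⟩
    exact ⟨r * c, by simp [hc, MvPolynomial.smul_eq_C_mul]⟩
  lie_mem' := by
    rintro D E ⟨c, hc⟩ ⟨d, hd⟩
    exact ⟨0, by simp [divergence_lie, hc, hd, MvPolynomial.derivation_C]⟩

/-- The action of `S̄₂` on the abelian Lie algebra `A₂` by derivations. -/
def derAction : SBar →ₗ⁅ℂ⁆ LieDerivation ℂ A₂ A₂ where
  toFun D :=
    { toLinearMap := (D : W₂).toLinearMap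
      leibniz' := fun f g => by
        simp [LieRing.of_associative_ring_bracket, mul_comm] }
  map_add' D E := by ext; rfl
  map_smul' c D := by ext; rfl
  map_lie' := by intro D E; ext f; rfl

/-- The semidirect product Lie algebra `S̃₂ = S̄₂ ⋉ A₂`, where `A₂` is an abelian ideal on which
`S̄₂` acts by derivations. -/
abbrev STilde : Type := LieAlgebra.SemiDirectSum A₂ SBar derAction

/-- The inclusion `A₂ → S̃₂`. -/
abbrev ofA : A₂ →ₗ⁅ℂ⁆ STilde := LieAlgebra.SemiDirectSum.inl derAction

/-- The inclusion `S̄₂ → S̃₂`. -/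
abbrev ofS : SBar →ₗ⁅ℂ⁆ STilde := LieAlgebra.SemiDirectSum.inr derAction

/-- The element `∂ᵢ` of `S̄₂`. -/
def partialS (i : Fin 2) : SBar :=
  ⟨MvPolynomial.pderiv i, 0, by
    simp [divergence, MvPolynomial.pderiv_X, Pi.single_apply, apply_ite]⟩

theorem partialS_lie (i j : Fin 2) : ⁅partialS i, partialS j⁆ = 0 := by
  apply Subtype.ext
  ext k
  simp [partialS, Derivation.commutator_apply, MvPolynomial.pderiv_X, Pi.single_apply, apply_ite]

theorem span_partialS_lie {x y : SBar}
    (hx : x ∈ Submodule.span ℂ (Set.range partialS))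
    (hy : y ∈ Submodule.span ℂ (Set.range partialS)) : ⁅x, y⁆ = 0 := by
  induction hx, hy using Submodule.span_induction₂ with
  | mem_mem x y hx hy =>
    obtain ⟨i, rfl⟩ := hx
    obtain ⟨j, rfl⟩ := hy
    exact partialS_lie i j
  | zero_left y hy => simp
  | zero_right x hx => simp
  | add_left x y z _ _ _ h1 h2 => simp [h1, h2]
  | add_right x y z _ _ _ h1 h2 => simp [h1, h2]
  | smul_left r x y _ _ h => simp [h]
  | smul_right r x y _ _ h => simp [h]

/-- The abelian subalgebra `Δ₂ = span {∂₁, ∂₂}` of `S̄₂`. -/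
def Delta : LieSubalgebra ℂ SBar :=
  { Submodule.span ℂ (Set.range partialS) with
    lie_mem' := by
      intro x y hx hy
      rw [span_partialS_lie hx hy]
      exact Submodule.zero_mem _ }

/-- The Lie algebra homomorphism `φ_a : Δ₂ → ℂ` with `φ_a (∂ᵢ) = aᵢ`
(the `i`-th coordinate of `x ∈ Δ₂` is the constant polynomial `x tᵢ`). -/
def phi (a : Fin 2 → ℂ) : Delta →ₗ⁅ℂ⁆ ℂ where
  toFun x := ∑ i, a i * MvPolynomial.constantCoeff (((x : SBar) : W₂) (MvPolynomial.X i))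
  map_add' x y := by simp [mul_add, Finset.sum_add_distrib]
  map_smul' c x := by
    simp [MvPolynomial.smul_eq_C_mul]
    ring
  map_lie' := by
    intro x y
    have h : ((⁅x, y⁆ : Delta) : SBar) = 0 := span_partialS_lie x.2 y.2
    rw [LieRing.of_associative_ring_bracket, mul_comm, sub_self, h]
    simp

theorem partialS_mem (i : Fin 2) : partialS i ∈ Delta :=
  Submodule.subset_span ⟨i, rfl⟩

theorem phi_partialS (a : Fin 2 → ℂ) (i : Fin 2) : phi a ⟨partialS i, partialS_mem i⟩ = a i := by
  change ∑ j, a j * MvPolynomial.constantCoeff (MvPolynomial.pderiv i (MvPolynomial.X j)) = a i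
  simp [MvPolynomial.pderiv_X, Pi.single_apply, apply_ite]

/-! ### Whittaker modules over `S̃₂` -/

section Modules

variable (M : Type u) [AddCommGroup M] [Module ℂ M] [LieRingModule STilde M] [LieModule ℂ STilde M]

/-- The operator by which `x ∈ Δ₂` acts on an `S̃₂`-module. -/
def deltaEnd (x : Delta) : Module.End ℂ M := LieModule.toEnd ℂ STilde M (ofS (x : SBar))

/-- An `S̃₂`-module is an `(A₂, S̄₂)`-module if `A₂` acts associatively (and unitally) on it. -/
structure IsASModule : Prop where
  mul_act : ∀ (f g : A₂) (v : M), ⁅ofA f, ⁅ofA g, v⁆⁆ = ⁅ofA (f * g), v⁆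
  one_act : ∀ v : M, ⁅ofA 1, v⁆ = v

/-- `M` is a Whittaker module: `Δ₂` acts locally finitely, i.e. every vector lies in a
finite-dimensional `Δ₂`-stable subspace. -/
def IsWhittaker : Prop :=
  ∀ v : M, ∃ N : Submodule ℂ M, v ∈ N ∧ FiniteDimensional ℂ N ∧
    ∀ x : Delta, ∀ w ∈ N, deltaEnd M x w ∈ N

/-- The Whittaker module `M` is of type `φ_a`, i.e. `M = M(a)`: for all `v` and all `x ∈ Δ₂`, some
power of `x - φ_a(x)` kills `v`. -/
def IsOfType (a : Fin 2 → ℂ) : Prop :=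
  ∀ v : M, ∀ x : Delta, ∃ k : ℕ, ((deltaEnd M x - phi a x • (1 : Module.End ℂ M)) ^ k) v = 0

/-- The space `Wh_a(M)` of Whittaker vectors: `x v = φ_a(x) v` for all `x ∈ Δ₂`. -/
def Wh (a : Fin 2 → ℂ) : Submodule ℂ M where
  carrier := {v | ∀ x : Delta, deltaEnd M x v = phi a x • v}
  add_mem' := by
    intro v w hv hw x
    rw [map_add, hv x, hw x, smul_add]
  zero_mem' := by
    intro x
    rw [map_zero, smul_zero]
  smul_mem' := by
    intro c v hv x
    rw [map_smul, hv x, smul_comm]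

end Modules

/-! ### The modules `T(A₂ᵃ, V)` -/

/-- The action of vector fields on the twisted module `A₂ᵃ`: `tᵢ` acts by multiplication and `∂ᵢ`
by `∂ᵢ + aᵢ`, so that `D = ∑ pᵢ ∂ᵢ` sends `f` to `∑ pᵢ (∂ᵢ + aᵢ) f = D f + (∑ aᵢ pᵢ) f`. -/
def twistedAct (a : Fin 2 → ℂ) : W₂ →ₗ[ℂ] Module.End ℂ A₂ where
  toFun D := D.toLinearMap + LinearMap.mulLeft ℂ (∑ i, a i • D (MvPolynomial.X i))
  map_add' D E := by
    refine LinearMap.ext fun f => ?_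
    simp [Fin.sum_univ_two]
    ring
  map_smul' c D := by
    refine LinearMap.ext fun f => ?_
    simp [Fin.sum_univ_two, MvPolynomial.smul_eq_C_mul]
    ring

/-- The Jacobian matrix of a vector field `D = ∑ pᵢ ∂ᵢ`; its `(j, i)` entry is `∂ⱼ pᵢ`. -/
def jacobian : W₂ →ₗ[ℂ] Matrix (Fin 2) (Fin 2) A₂ where
  toFun D := Matrix.of fun j i => MvPolynomial.pderiv j (D (MvPolynomial.X i))
  map_add' D E := by
    ext j i : 2
    simp
  map_smul' c D := by
    ext j i : 2
    simp

section Tensor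

variable (V : Type u) [AddCommGroup V] [Module ℂ V] [LieRingModule gl₂ V] [LieModule ℂ gl₂ V]

/-- The action of `gl₂(A₂) = A₂ ⊗ gl₂` on `A₂ ⊗ V`: the matrix `G` acts by
`f ⊗ v ↦ ∑ j, ∑ i, G_{ji} f ⊗ E_{ji} v`. -/
def matAct : Matrix (Fin 2) (Fin 2) A₂ →ₗ[ℂ] Module.End ℂ (A₂ ⊗[ℂ] V) where
  toFun G := ∑ j, ∑ i, TensorProduct.map (LinearMap.mulLeft ℂ (G j i))
    (LieModule.toEnd ℂ gl₂ V (Matrix.single j i 1))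
  map_add' G H := by
    refine TensorProduct.ext' fun f v => ?_
    simp [Fin.sum_univ_two, add_mul, TensorProduct.add_tmul]
    abel
  map_smul' c G := by
    refine TensorProduct.ext' fun f v => ?_
    simp [Fin.sum_univ_two, TensorProduct.smul_tmul', smul_add]

/-- The operator by which `(D, f) ∈ S̄₂ ⋉ A₂` acts on `T(A₂ᵃ, V) = A₂ᵃ ⊗ V`. For `D = ∑ pᵢ ∂ᵢ`,
`(D, f) (p ⊗ v) = (D p + ∑ aᵢ pᵢ p) ⊗ v + ∑ j, ∑ i, (∂ⱼ pᵢ) p ⊗ E_{ji} v + (f p) ⊗ v`. -/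
def tensorAct (a : Fin 2 → ℂ) : STilde →ₗ[ℂ] Module.End ℂ (A₂ ⊗[ℂ] V) where
  toFun x := TensorProduct.map (twistedAct a (x.right : W₂)) LinearMap.id
    + matAct V (jacobian (x.right : W₂))
    + TensorProduct.map (LinearMap.mulLeft ℂ x.left) LinearMap.id
  map_add' x y := by
    refine TensorProduct.ext' fun p v => ?_
    simp [add_mul, TensorProduct.add_tmul]
    abel
  map_smul' c x := by
    refine TensorProduct.ext' fun p v => ?_
    simp [TensorProduct.smul_tmul']

theorem twistedAct_lie (a : Fin 2 → ℂ) (D E : W₂) (p : A₂) :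
    twistedAct a ⁅D, E⁆ p
      = twistedAct a D (twistedAct a E p) - twistedAct a E (twistedAct a D p) := by
  have h : ∀ (D : W₂) (q : A₂), twistedAct a D q
      = D q + (∑ i, a i • D (MvPolynomial.X i)) * q := fun _ _ => rfl
  simp only [h, Derivation.commutator_apply, Fin.sum_univ_two, MvPolynomial.smul_eq_C_mul,
    map_add, Derivation.leibniz, smul_eq_mul, MvPolynomial.derivation_C]
  ring

theorem twistedAct_mul (a : Fin 2 → ℂ) (D : W₂) (g p : A₂) :
    twistedAct a D (g * p) = D g * p + g * twistedAct a D p := by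
  simp [twistedAct]
  ring

theorem jacobian_lie (D E : W₂) :
    jacobian ⁅D, E⁆ = (jacobian E).map D - (jacobian D).map E
      + (jacobian D * jacobian E - jacobian E * jacobian D) := by
  refine Matrix.ext fun j i => ?_
  simp only [jacobian, LinearMap.coe_mk, AddHom.coe_mk, Matrix.of_apply, Matrix.add_apply,
    Matrix.sub_apply, Matrix.map_apply, Matrix.mul_apply, Fin.sum_univ_two,
    Derivation.commutator_apply, map_sub]
  rw [pderiv_apply _ D (E _), pderiv_apply _ E (D _)]
  simp only [Fin.sum_univ_two]
  ring

theorem matAct_tmul (G : Matrix (Fin 2) (Fin 2) A₂) (p : A₂) (v : V) :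
    matAct V G (p ⊗ₜ v) = ∑ j, ∑ i, (G j i * p) ⊗ₜ ⁅(Matrix.single j i 1 : gl₂), v⁆ := by
  simp [matAct]

theorem matAct_lie (G H : Matrix (Fin 2) (Fin 2) A₂) :
    matAct V (G * H - H * G) = matAct V G * matAct V H - matAct V H * matAct V G := by
  have key : ∀ j i l k : Fin 2, ∀ v : V,
      ⁅(Matrix.single j i 1 : gl₂), ⁅(Matrix.single l k 1 : gl₂), v⁆⁆
        = ⁅(Matrix.single l k 1 : gl₂), ⁅(Matrix.single j i 1 : gl₂), v⁆⁆
          + ((if i = l then ⁅(Matrix.single j k 1 : gl₂), v⁆ else 0)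
          - (if k = j then ⁅(Matrix.single l i 1 : gl₂), v⁆ else 0)) := by
    intro j i l k v
    have h := lie_lie (Matrix.single j i (1 : ℂ) : gl₂) (Matrix.single l k (1 : ℂ) : gl₂) v
    rw [← sub_eq_iff_eq_add', ← h, LieRing.of_associative_ring_bracket, sub_lie]
    congr 1
    · split_ifs with hh
      · subst hh; simp
      · simp [hh]
    · split_ifs with hh
      · subst hh; simp
      · simp [hh]
  refine TensorProduct.ext' fun p v => ?_
  simp only [LinearMap.sub_apply, Module.End.mul_apply, matAct_tmul, Fin.sum_univ_two,
    map_add, Matrix.sub_apply, Matrix.mul_apply]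
  simp only [mul_left_comm (H _ _) (G _ _) p]
  simp only [key 0 0 0 1, key 0 0 1 0, key 0 0 1 1, key 0 1 1 0, key 0 1 1 1, key 1 0 1 1,
    if_true, one_ne_zero, zero_ne_one, if_false, TensorProduct.tmul_add, TensorProduct.tmul_sub,
    TensorProduct.tmul_zero, add_mul, sub_mul, TensorProduct.add_tmul, TensorProduct.sub_tmul,
    mul_assoc, mul_left_comm (H _ _) (G _ _) p]
  abel

theorem tensorAct_lie (a : Fin 2 → ℂ) (x y : STilde) :
    tensorAct V a ⁅x, y⁆
      = tensorAct V a x * tensorAct V a y - tensorAct V a y * tensorAct V a x := by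
  obtain ⟨f, D⟩ := x
  obtain ⟨g, E⟩ := y
  refine TensorProduct.ext' fun p v => ?_
  have h : ∀ (f : A₂) (D : SBar) (p : A₂) (v : V), tensorAct V a ⟨f, D⟩ (p ⊗ₜ v)
      = twistedAct a (D : W₂) p ⊗ₜ v + matAct V (jacobian (D : W₂)) (p ⊗ₜ v)
        + (f * p) ⊗ₜ v := fun _ _ _ _ => rfl
  have hb : ⁅(⟨f, D⟩ : STilde), (⟨g, E⟩ : STilde)⁆
      = ⟨(D : W₂) g - (E : W₂) f, ⁅D, E⁆⟩ := by
    rw [LieAlgebra.SemiDirectSum.lie_eq_mk, LieRing.of_associative_ring_bracket, mul_comm, sub_self,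
      zero_add]
    rfl
  have hm := congrArg (fun T : Module.End ℂ (A₂ ⊗[ℂ] V) => T (p ⊗ₜ v))
    (matAct_lie V (jacobian (D : W₂)) (jacobian (E : W₂)))
  simp only [LinearMap.sub_apply, Module.End.mul_apply] at hm
  rw [hb, h, LieSubalgebra.coe_bracket, jacobian_lie, map_add, LinearMap.add_apply, hm,
    twistedAct_lie]
  simp only [LinearMap.sub_apply, Module.End.mul_apply, h, map_add]
  simp only [matAct_tmul, map_sub, LinearMap.sub_apply, map_add, h, Fin.sum_univ_two,
    twistedAct_mul, Matrix.map_apply, TensorProduct.add_tmul, TensorProduct.sub_tmul, sub_mul]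
  simp only [mul_left_comm f (jacobian _ _ _) p, mul_left_comm g (jacobian _ _ _) p,
    mul_left_comm g f p]
  abel

/-- The underlying vector space `A₂ᵃ ⊗ V` of the module `T(A₂ᵃ, V)`. -/
def T (_a : Fin 2 → ℂ) (V : Type u) [AddCommGroup V] [Module ℂ V] : Type u := A₂ ⊗[ℂ] V

instance (a : Fin 2 → ℂ) : AddCommGroup (T a V) := inferInstanceAs (AddCommGroup (A₂ ⊗[ℂ] V))

instance (a : Fin 2 → ℂ) : Module ℂ (T a V) := inferInstanceAs (Module ℂ (A₂ ⊗[ℂ] V))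

/-- The `S̃₂`-module `T(A₂ᵃ, V)`, with the action `tensorAct`. -/
instance (a : Fin 2 → ℂ) : LieRingModule STilde (T a V) where
  bracket x w := tensorAct V a x w
  add_lie x y w := LinearMap.congr_fun ((tensorAct V a).map_add x y) w
  lie_add x w w' := (tensorAct V a x).map_add w w'
  leibniz_lie x y w :=
    (eq_sub_iff_add_eq.mp (LinearMap.congr_fun (tensorAct_lie V a x y) w)).symm

instance (a : Fin 2 → ℂ) : LieModule ℂ STilde (T a V) where
  smul_lie c x w := LinearMap.congr_fun ((tensorAct V a).map_smul c x) w
  lie_smul c x w := (tensorAct V a x).map_smul c w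

end Tensor

end CartanS

end

/-! The operators `∂ᵢ - aᵢ` and multiplication by `tᵢ` make `M` a module over the Weyl algebra on
which the `∂ᵢ - aᵢ` are locally nilpotent. Hence `M = Wh_a(M) ⊕ 𝔪M`, with `𝔪` the maximal ideal of
the origin, and every nonzero subspace stable under the `∂ᵢ - aᵢ` contains a nonzero Whittaker
vector (`IsNilpotentWeyl`). So `Wh_a(M)` is identified with the fibre `M/𝔪M`
(`toFiber_Wh_bijective`), on which the fields vanishing at the origin act, among them the linear
fields, a copy of `gl₂`.

The fibre is finite-dimensional and nonzero. Fields of order at least two raise eigenvalues of the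
Euler field, so they kill an eigenvector of maximal real part (`exists_ne_zero_forall_higher_lie`).
The vectors killed by all such fields form a nonzero `gl₂`-submodule; `V` is a simple submodule of
it.

Lifting `V` to Whittaker vectors and extending `A₂`-linearly gives `T(A₂ᵃ, V) → M`. Its failure to
be equivariant spans a space inside `𝔪M` stable under the `∂ᵢ - aᵢ`; such a space is zero
(`comparison_lie_pureT_one`). The map is injective because a nonzero kernel would contain some `1 ⊗
v ≠ 0`, and surjective because `M` is simple. -/

noncomputable section

namespace CartanS

/-! ### Weyl algebra representations with locally nilpotent derivations -/

section Weyl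

variable {M : Type u} [AddCommGroup M] [Module ℂ M]

theorem pow_apply_of_weyl {d t : Module.End ℂ M} (h : ∀ x, d (t x) = t (d x) + x) (n : ℕ) (x : M) :
    (d ^ (n + 1)) (t x) = t ((d ^ (n + 1)) x) + ((n : ℂ) + 1) • (d ^ n) x := by
  induction n with
  | zero => simp [h]
  | succ n ih =>
    rw [pow_succ' d (n + 1), Module.End.mul_apply, ih, map_add, h, map_smul,
      ← Module.End.mul_apply d, ← Module.End.mul_apply d, ← pow_succ', ← pow_succ']
    push_cast
    module

/-- If `d ^ (n + 1)` kills `x`, the commutation formula reduces to `(n + 1) • d ^ n x = 0`, so the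
nilpotency order descends to `0`. -/
theorem eq_zero_of_weyl {d t : Module.End ℂ M} (h : ∀ x, d (t x) = t (d x) + x)
    (hd : ∀ x, ∃ n : ℕ, (d ^ n) x = 0) {x : M} (hx : d (t x) = 0) : x = 0 := by
  obtain ⟨n, hn⟩ := hd x
  induction n with
  | zero => simpa using hn
  | succ n ih =>
    have h1 := pow_apply_of_weyl h n x
    rw [hn, pow_succ, Module.End.mul_apply, hx, map_zero, map_zero, zero_add] at h1
    exact ih ((smul_eq_zero.mp h1.symm).resolve_left (by exact_mod_cast n.succ_ne_zero))

/-- Subtracting a multiple of `t (d x)` from `x` lowers the nilpotency order. The stable subspace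
`N` allows the result to be used inside the kernel of the other derivation. -/
theorem exists_add_of_weyl {d t : Module.End ℂ M} (h : ∀ x, d (t x) = t (d x) + x)
    (hd : ∀ x, ∃ n : ℕ, (d ^ n) x = 0) (N : Submodule ℂ M) (hdN : ∀ x ∈ N, d x ∈ N)
    (htN : ∀ x ∈ N, t x ∈ N) {x : M} (hx : x ∈ N) :
    ∃ w ∈ N, d w = 0 ∧ ∃ y ∈ N, x = w + t y := by
  obtain ⟨n, hn⟩ := hd x
  induction n generalizing x with
  | zero => exact ⟨0, N.zero_mem, map_zero d, 0, N.zero_mem, by simpa using hn⟩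
  | succ n ih =>
    cases n with
    | zero => exact ⟨x, hx, by simpa using hn, 0, N.zero_mem, by simp⟩
    | succ n =>
      have hc : (n : ℂ) + 1 ≠ 0 := by exact_mod_cast n.succ_ne_zero
      -- On `d x`, killed by `d ^ (n + 1)`, the operator `d ^ (n + 1) ∘ t` equals `(n + 1) • d ^ n`;
      -- this fixes the coefficient.
      obtain ⟨w, hw, hdw, y, hy, e⟩ := ih
        (N.sub_mem hx (N.smul_mem ((n : ℂ) + 1)⁻¹ (htN _ (hdN _ hx)))) (by
          rw [map_sub, map_smul, pow_apply_of_weyl h n (d x), ← Module.End.mul_apply _ d x,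
            ← Module.End.mul_apply _ d x, ← pow_succ, ← pow_succ, hn, map_zero, zero_add,
            smul_smul, inv_mul_cancel₀ hc, one_smul, sub_self])
      refine ⟨w, hw, hdw, y + ((n : ℂ) + 1)⁻¹ • d x, N.add_mem hy (N.smul_mem _ (hdN _ hx)), ?_⟩
      rw [map_add, ← add_assoc, ← e, map_smul, sub_add_cancel]

theorem exists_mem_ker_of_stable {d : Module.End ℂ M} (hd : ∀ x, ∃ n : ℕ, (d ^ n) x = 0)
    (N : Submodule ℂ M) (hdN : ∀ x ∈ N, d x ∈ N) (hN : N ≠ ⊥) : ∃ w ∈ N, w ≠ 0 ∧ d w = 0 := by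
  obtain ⟨x, hx, hx0⟩ := N.exists_mem_ne_zero_of_ne_bot hN
  obtain ⟨n, hn⟩ := hd x
  induction n generalizing x with
  | zero => exact absurd (by simpa using hn) hx0
  | succ n ih =>
    by_cases h : d x = 0
    · exact ⟨x, hx, hx0, h⟩
    · exact ih (d x) (hdN x hx) h (by rwa [pow_succ, Module.End.mul_apply] at hn)

/-- A representation of the second Weyl algebra, by operators `t i` and `d i`, on which the `d i`
are locally nilpotent. -/
structure IsNilpotentWeyl (d t : Fin 2 → Module.End ℂ M) : Prop where
  d_t : ∀ i x, d i (t i x) = t i (d i x) + x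
  d_t_ne : ∀ i j x, i ≠ j → d i (t j x) = t j (d i x)
  d_d : ∀ i j x, d i (d j x) = d j (d i x)
  t_t : ∀ i j x, t i (t j x) = t j (t i x)
  nil : ∀ i x, ∃ n : ℕ, (d i ^ n) x = 0

namespace IsNilpotentWeyl

variable {d t : Fin 2 → Module.End ℂ M} (h : IsNilpotentWeyl d t)
include h

theorem exists_mem_ker (N : Submodule ℂ M) (hN : ∀ i, ∀ x ∈ N, d i x ∈ N) (hN0 : N ≠ ⊥) :
    ∃ w ∈ N, w ≠ 0 ∧ ∀ i, d i w = 0 := by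
  obtain ⟨w, hw, hw0, hdw⟩ := exists_mem_ker_of_stable (h.nil 0) N (hN 0) hN0
  obtain ⟨z, ⟨hz, hz0⟩, hz1, hz2⟩ := exists_mem_ker_of_stable (h.nil 1) (N ⊓ LinearMap.ker (d 0))
    (fun x hx => ⟨hN 1 x hx.1, by
      have := hx.2
      simp only [SetLike.mem_coe, LinearMap.mem_ker] at this ⊢
      rw [h.d_d, this, map_zero]⟩)
    (fun e => hw0 (by
      have : w ∈ N ⊓ LinearMap.ker (d 0) := ⟨hw, hdw⟩
      rwa [e, Submodule.mem_bot] at this))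
  exact ⟨z, hz, hz1, fun i => by fin_cases i; exacts [hz0, hz2]⟩

theorem exists_add (x : M) :
    ∃ w, (∀ i, d i w = 0) ∧ ∃ y z, x = w + t 0 y + t 1 z := by
  obtain ⟨w, -, hw, y, -, rfl⟩ := exists_add_of_weyl (h.d_t 0) (h.nil 0) ⊤ (by simp) (by simp)
    (Submodule.mem_top (x := x))
  obtain ⟨w', hw', hw1, z, hz, rfl⟩ := exists_add_of_weyl (h.d_t 1) (h.nil 1) (LinearMap.ker (d 0))
    (fun x hx => by rw [LinearMap.mem_ker] at hx ⊢; rw [h.d_d, hx, map_zero])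
    (fun x hx => by
      rw [LinearMap.mem_ker] at hx ⊢; rw [h.d_t_ne 0 1 _ (by decide), hx, map_zero])
    (LinearMap.mem_ker.mpr hw)
  exact ⟨w', fun i => by fin_cases i; exacts [hw', hw1], y, z, by abel⟩

/-- Once `z` is replaced by its part killed by `d 0`, the term in `t 0` is itself killed by `d 0`
and so vanishes; the same argument with `d 1` removes the rest. -/
theorem eq_zero_of_eq_add {w y z : M} (hw : ∀ i, d i w = 0) (e : w = t 0 y + t 1 z) : w = 0 := by
  obtain ⟨z', -, hz', y', -, rfl⟩ := exists_add_of_weyl (h.d_t 0) (h.nil 0) ⊤ (by simp) (by simp)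
    (Submodule.mem_top (x := z))
  have e1 : w - t 1 z' = t 0 (y + t 1 y') := by
    rw [e, map_add, map_add, h.t_t 0 1]; abel
  have h1 : d 0 (w - t 1 z') = 0 := by
    rw [map_sub, hw, h.d_t_ne 0 1 _ (by decide), hz', map_zero, sub_zero]
  have h0 : y + t 1 y' = 0 := eq_zero_of_weyl (h.d_t 0) (h.nil 0) (by rw [← e1, h1])
  rw [h0, map_zero, sub_eq_zero] at e1
  have h2 := hw 1
  rw [e1] at h2
  rw [e1, eq_zero_of_weyl (h.d_t 1) (h.nil 1) h2, map_zero]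

end IsNilpotentWeyl

end Weyl

/-! ### Vector fields vanishing at the origin, graded by the Euler field -/

section VectorFields

open MvPolynomial

theorem coe_partialS (i : Fin 2) : (partialS i : W₂) = pderiv i := rfl

theorem sbar_ext {D E : SBar} (h : ∀ i, (D : W₂) (X i) = (E : W₂) (X i)) : D = E :=
  Subtype.ext (MvPolynomial.derivation_ext h)

/-- The subalgebra of the vector fields in `S̄₂` which vanish at the origin. -/
def vanishing : LieSubalgebra ℂ SBar where
  carrier := {D | ∀ i, constantCoeff ((D : W₂) (X i)) = 0}
  add_mem' {D E} hD hE i := by simp [hD i, hE i]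
  zero_mem' i := by simp
  smul_mem' c D hD i := by simp [hD i]
  lie_mem' {D E} hD hE i := by
    have h : ∀ (D : SBar), (∀ i, constantCoeff ((D : W₂) (X i)) = 0) → ∀ f,
        constantCoeff ((D : W₂) f) = 0 := fun D hD f => by
      rw [apply_eq_sum, map_sum]
      exact Finset.sum_eq_zero fun k _ => by rw [map_mul, hD, zero_mul]
    rw [LieSubalgebra.coe_bracket, Derivation.commutator_apply, map_sub, h D hD, h E hE, sub_zero]

theorem constantCoeff_vanishing_apply (D : vanishing) (f : A₂) :
    constantCoeff (((D : SBar) : W₂) f) = 0 := by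
  rw [apply_eq_sum, map_sum]
  exact Finset.sum_eq_zero fun k _ => by rw [map_mul, D.2, zero_mul]

/-- The vector field with coefficients `∑ j, G j i • tⱼ`. -/
def linearField (G : gl₂) : W₂ := mkDerivation ℂ fun i => ∑ j, G j i • (X j : A₂)

@[simp]
theorem linearField_X (G : gl₂) (i : Fin 2) : linearField G (X i) = ∑ j, G j i • (X j : A₂) :=
  mkDerivation_X ..

/-- The embedding of `gl₂` as the linear vector fields, `E_{ji} ↦ tⱼ ∂ᵢ`. -/
def linearFieldHom : gl₂ →ₗ⁅ℂ⁆ vanishing where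
  toFun G := ⟨⟨linearField G, ∑ i, G i i, by
    simp [divergence, pderiv_X, Fin.sum_univ_two, smul_eq_C_mul]⟩, fun i => by
      simp⟩
  map_add' G H := by
    refine Subtype.ext (sbar_ext fun i => ?_)
    simp [add_smul, Finset.sum_add_distrib]
  map_smul' c G := by
    refine Subtype.ext (sbar_ext fun i => ?_)
    simp [mul_smul]
  map_lie' {G H} := by
    refine Subtype.ext (sbar_ext fun i => ?_)
    simp [Derivation.commutator_apply, LieRing.of_associative_ring_bracket, Fin.sum_univ_two,
      Matrix.mul_apply]
    module

@[simp]
theorem coe_linearFieldHom (G : gl₂) : ((linearFieldHom G : SBar) : W₂) = linearField G := rfl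

/-- The linear part at the origin of a vector field. -/
def linearPart (D : W₂) : gl₂ := Matrix.of fun j i => constantCoeff (pderiv j (D (X i)))

/-- The vector fields in `S̄₂` with vanishing constant and linear terms. -/
def higher : Submodule ℂ vanishing where
  carrier := {D | linearPart ((D : SBar) : W₂) = 0}
  add_mem' {D E} hD hE := by
    ext j i
    have h1 := congr_fun₂ hD j i
    have h2 := congr_fun₂ hE j i
    simp [linearPart] at h1 h2 ⊢
    rw [h1, h2, add_zero]
  zero_mem' := by ext j i; simp [linearPart]
  smul_mem' c D hD := by
    ext j i
    have h1 := congr_fun₂ hD j i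
    simp [linearPart] at h1 ⊢
    exact Or.inr h1

theorem mem_higher {D : vanishing} :
    D ∈ higher ↔ ∀ j i, constantCoeff (pderiv j (((D : SBar) : W₂) (X i))) = 0 :=
  ⟨fun h j i => congr_fun₂ h j i, fun h => by ext j i; exact h j i⟩

theorem sub_linearFieldHom_mem_higher (D : vanishing) :
    D - linearFieldHom (linearPart ((D : SBar) : W₂)) ∈ higher := by
  rw [mem_higher]
  intro j i
  simp [linearPart, pderiv_X, Pi.single_apply, Fin.sum_univ_two]
  fin_cases j <;> simp

/-- By the product rule, each term of the linear part of the bracket has a factor that vanishes at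
the origin. So `higher` is an ideal, which makes its invariants stable under `gl₂`. -/
theorem lie_mem_higher (D : vanishing) {E : vanishing} (hE : E ∈ higher) : ⁅E, D⁆ ∈ higher := by
  rw [mem_higher] at *
  intro j i
  rw [LieSubalgebra.coe_bracket, LieSubalgebra.coe_bracket, Derivation.commutator_apply, map_sub,
    pderiv_apply j ((E : SBar) : W₂),
    pderiv_apply j ((D : SBar) : W₂) (((E : SBar) : W₂) (X i))]
  simp [constantCoeff_vanishing_apply, hE]

theorem linearField_one_apply {p : A₂} {n : ℕ} (hp : p.IsHomogeneous n) :
    linearField 1 p = (n : ℂ) • p := by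
  rw [apply_eq_sum, Nat.cast_smul_eq_nsmul, ← hp.sum_X_mul_pderiv]
  simp [Fin.sum_univ_two, Matrix.one_apply]

theorem homogeneousComponent_pderiv (k : ℕ) (i : Fin 2) (p : A₂) :
    homogeneousComponent k (pderiv i p) = pderiv i (homogeneousComponent (k + 1) p) := by
  ext m
  rw [coeff_homogeneousComponent, coeff_pderiv, coeff_pderiv, coeff_homogeneousComponent]
  simp [map_add]

/-- The part of a vector field with coefficients homogeneous of degree `k + 1`. -/
def homogeneousPart (k : ℕ) (D : W₂) : W₂ :=
  mkDerivation ℂ fun i => homogeneousComponent (k + 1) (D (X i))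

@[simp]
theorem homogeneousPart_X (k : ℕ) (D : W₂) (i : Fin 2) :
    homogeneousPart k D (X i) = homogeneousComponent (k + 1) (D (X i)) :=
  mkDerivation_X ..

/-- Divergence respects the grading, and a homogeneous component of a constant is again a constant.
-/
theorem homogeneousPart_mem (k : ℕ) (D : SBar) : homogeneousPart k (D : W₂) ∈ SBar := by
  obtain ⟨c, hc⟩ := D.2
  have h : divergence (homogeneousPart k (D : W₂))
      = homogeneousComponent k (divergence (D : W₂)) := by
    simp [divergence, homogeneousComponent_pderiv]
  refine ⟨if 0 = k then c else 0, ?_⟩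
  rw [h, hc, homogeneousComponent_of_mem (isHomogeneous_C _ c)]
  by_cases hk : 0 = k
  · rw [if_pos hk, if_pos hk.symm]
  · rw [if_neg hk, if_neg (Ne.symm hk), map_zero]

/-- `homogeneousPart` as an endomap of the vector fields in `S̄₂` vanishing at the origin. -/
def vanishingPart (k : ℕ) (D : vanishing) : vanishing :=
  ⟨⟨homogeneousPart k ((D : SBar) : W₂), homogeneousPart_mem k D⟩, fun i => by
    rw [homogeneousPart_X, constantCoeff_eq, coeff_homogeneousComponent, map_zero,
      if_neg (Nat.succ_ne_zero k).symm]⟩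

/-- The Euler field multiplies coefficients of degree `k + 1` by `k + 1`, and the bracket with `∂ᵢ`
removes one. -/
theorem lie_vanishingPart (k : ℕ) (D : vanishing) :
    ⁅linearFieldHom 1, vanishingPart k D⁆ = (k : ℂ) • vanishingPart k D := by
  refine Subtype.ext (sbar_ext fun i => ?_)
  simp only [LieSubalgebra.coe_bracket, Derivation.commutator_apply]
  change linearField 1 (homogeneousPart k ((D : SBar) : W₂) (X i))
    - homogeneousPart k ((D : SBar) : W₂) (linearField 1 (X i))
    = (k : ℂ) • homogeneousPart k ((D : SBar) : W₂) (X i)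
  rw [linearField_one_apply (isHomogeneous_X ℂ i), homogeneousPart_X,
    linearField_one_apply (homogeneousComponent_isHomogeneous _ _), Derivation.map_smul, homogeneousPart_X]
  push_cast
  module

theorem homogeneousComponent_one_eq_zero {p : A₂} (hp : ∀ j, constantCoeff (pderiv j p) = 0) :
    homogeneousComponent 1 p = 0 := by
  have h := (homogeneousComponent_isHomogeneous 1 p).sum_X_mul_pderiv
  rw [one_smul] at h
  rw [← h]
  refine Finset.sum_eq_zero fun j _ => ?_
  rw [← homogeneousComponent_pderiv, homogeneousComponent_zero, ← constantCoeff_eq, hp]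
  simp

theorem sum_homogeneousComponent_of_lt {p : A₂} {N : ℕ} (h : p.totalDegree < N) :
    ∑ k ∈ Finset.range N, homogeneousComponent k p = p := by
  conv_rhs => rw [← sum_homogeneousComponent p]
  refine (Finset.sum_subset (by simpa using h) fun k _ hk => ?_).symm
  exact homogeneousComponent_eq_zero _ _ (by simpa [Nat.lt_succ_iff] using hk)

/-- The components of degree `0` and `1` are missing, so only the parts of positive Euler weight
remain. -/
theorem higher_le_span : higher ≤ Submodule.span ℂ
    {E : vanishing | ∃ k : ℕ, ⁅linearFieldHom 1, E⁆ = ((k : ℂ) + 1) • E} := by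
  intro D hD
  obtain ⟨N, hN⟩ : ∃ N, ∀ i, (((D : SBar) : W₂) (X i)).totalDegree < N + 2 :=
    ⟨∑ i, (((D : SBar) : W₂) (X i)).totalDegree, fun i =>
      (Finset.single_le_sum (f := fun i => (((D : SBar) : W₂) (X i)).totalDegree)
        (fun _ _ => Nat.zero_le _) (Finset.mem_univ i)).trans_lt (by omega)⟩
  have h : D = ∑ k ∈ Finset.range N, vanishingPart (k + 1) D := by
    refine Subtype.ext (sbar_ext fun i => ?_)
    have h1 : ∀ s : Finset ℕ, (((∑ k ∈ s, vanishingPart (k + 1) D : vanishing) : SBar) : W₂) (X i)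
        = ∑ k ∈ s, homogeneousComponent (k + 2) (((D : SBar) : W₂) (X i)) := fun s => by
      induction s using Finset.cons_induction with
      | empty => simp
      | cons a s ha ih =>
        rw [Finset.sum_cons, Finset.sum_cons, ← ih, ← homogeneousPart_X]
        rfl
    rw [h1]
    conv_lhs => rw [← sum_homogeneousComponent_of_lt (hN i)]
    rw [Finset.sum_range_succ', Finset.sum_range_succ',
      homogeneousComponent_one_eq_zero (fun j => mem_higher.mp hD j i), homogeneousComponent_zero,
      ← constantCoeff_eq, D.2 i]
    simp
  rw [h]
  refine Submodule.sum_mem _ fun k _ => Submodule.subset_span ⟨k, ?_⟩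
  rw [lie_vanishingPart]
  push_cast
  rfl

end VectorFields

/-! ### Polynomials near the origin and vectors of extremal Euler weight -/

open MvPolynomial

theorem exists_eq_C_add (f : A₂) :
    ∃ g h : A₂, f = C (constantCoeff f) + X 0 * g + X 1 * h := by
  induction f using MvPolynomial.induction_on with
  | C c => exact ⟨0, 0, by simp⟩
  | add p q hp hq =>
    obtain ⟨g, h, e⟩ := hp
    obtain ⟨g', h', e'⟩ := hq
    refine ⟨g + g', h + h', ?_⟩
    conv_lhs => rw [e, e']
    rw [map_add, C_add]
    ring
  | mul_X p i _ =>
    fin_cases i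
    · exact ⟨p, 0, by simp [mul_comm]⟩
    · exact ⟨0, p, by simp [mul_comm]⟩

theorem exists_pderiv_pow_eq_zero (i : Fin 2) (p : A₂) :
    ∃ n : ℕ, ((pderiv i : W₂).toLinearMap ^ n) p = 0 := by
  have h : ∀ (n : ℕ) (p : A₂), (∀ m : Fin 2 →₀ ℕ, n ≤ m i → coeff m p = 0) →
      ((pderiv i : W₂).toLinearMap ^ n) p = 0 := by
    intro n
    induction n with
    | zero =>
      intro p hp
      ext m
      simpa using hp m (Nat.zero_le _)
    | succ n ih =>
      intro p hp
      rw [pow_succ, Module.End.mul_apply]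
      refine ih _ fun m hm => ?_
      change coeff m (pderiv i p) = 0
      rw [coeff_pderiv, hp _ (by simpa using hm), zero_mul]
  refine ⟨p.support.sup (fun m => m i) + 1, h _ p fun m hm => ?_⟩
  by_contra hc
  have : m i ≤ _ := Finset.le_sup (f := fun m : Fin 2 →₀ ℕ => m i) (mem_support_iff.mpr hc)
  omega

/-- A field of Euler weight `k + 1` sends an eigenvector for `l` to one for `l + k + 1`, or to zero.
The former is impossible when `l` has maximal real part among the finitely many eigenvalues. -/
theorem exists_ne_zero_forall_higher_lie (Q : Type u) [AddCommGroup Q] [Module ℂ Q]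
    [LieRingModule vanishing Q] [LieModule ℂ vanishing Q] [FiniteDimensional ℂ Q] [Nontrivial Q] :
    ∃ q : Q, q ≠ 0 ∧ ∀ x ∈ higher, ⁅x, q⁆ = 0 := by
  set E := LieModule.toEnd ℂ vanishing Q (linearFieldHom 1)
  obtain ⟨l, hl, hmax⟩ := Set.exists_max_image {l : ℂ | E.HasEigenvalue l} Complex.re
    E.finite_hasEigenvalue E.exists_eigenvalue
  obtain ⟨q, hq⟩ := Module.End.HasEigenvalue.exists_hasEigenvector hl
  refine ⟨q, hq.2, fun x hx => ?_⟩
  replace hx := higher_le_span hx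
  induction hx using Submodule.span_induction with
  | mem x hx =>
    obtain ⟨k, hk⟩ := hx
    by_contra h0
    have h1 : E ⁅x, q⁆ = (l + (k + 1)) • ⁅x, q⁆ := by
      have h2 : ⁅linearFieldHom 1, q⁆ = l • q := hq.apply_eq_smul
      change ⁅linearFieldHom 1, ⁅x, q⁆⁆ = _
      rw [leibniz_lie, hk, h2, smul_lie, lie_smul]
      module
    have h2 := hmax _ (Module.End.hasEigenvalue_of_hasEigenvector
      ⟨Module.End.mem_eigenspace_iff.mpr h1, h0⟩)
    simp at h2
    have : (0 : ℝ) ≤ k := Nat.cast_nonneg k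
    linarith
  | zero => exact zero_lie q
  | add x y _ _ hx hy => rw [add_lie, hx, hy, add_zero]
  | smul c x _ hx => rw [smul_lie, hx, smul_zero]

/-! ### Whittaker vectors and the fibre at the origin -/

section Modules

variable (M : Type u) [AddCommGroup M] [Module ℂ M] [LieRingModule STilde M] [LieModule ℂ STilde M]

instance : LieRingModule SBar M := LieRingModule.compLieHom M ofS

instance : LieModule ℂ SBar M := LieModule.compLieHom M ofS

/-- The action of polynomials on an `S̃₂`-module. -/
def polyAct : A₂ →ₗ[ℂ] Module.End ℂ M :=
  (LieModule.toEnd ℂ STilde M : STilde →ₗ[ℂ] Module.End ℂ M) ∘ₗ (ofA : A₂ →ₗ[ℂ] STilde)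

variable {M}

theorem lie_polyAct (D : SBar) (f : A₂) (v : M) :
    ⁅D, polyAct M f v⁆ = polyAct M ((D : W₂) f) v + polyAct M f ⁅D, v⁆ := by
  have h : ⁅ofS D, ofA f⁆ = ofA ((D : W₂) f) := by
    refine LieAlgebra.SemiDirectSum.ext ?_ ?_
    · simp only [LieAlgebra.SemiDirectSum.lie_eq_mk, LieAlgebra.SemiDirectSum.inl_eq_mk,
        LieAlgebra.SemiDirectSum.inr_eq_mk, zero_lie, zero_add, map_zero, sub_zero]
      rfl
    · simp only [LieAlgebra.SemiDirectSum.lie_eq_mk, LieAlgebra.SemiDirectSum.inl_eq_mk,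
        LieAlgebra.SemiDirectSum.inr_eq_mk, lie_zero]
  change ⁅ofS D, ⁅ofA f, v⁆⁆ = ⁅ofA ((D : W₂) f), v⁆ + ⁅ofA f, ⁅ofS D, v⁆⁆
  rw [leibniz_lie, h]

theorem stilde_lie_eq (x : STilde) (v : M) : ⁅x, v⁆ = polyAct M x.left v + ⁅x.right, v⁆ := by
  have h : x = ofA x.left + ofS x.right :=
    LieAlgebra.SemiDirectSum.ext (add_zero _).symm (zero_add _).symm
  conv_lhs => rw [h]
  exact add_lie _ _ _

theorem IsASModule.polyAct_mul (hM : IsASModule M) (f g : A₂) (v : M) :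
    polyAct M (f * g) v = polyAct M f (polyAct M g v) := (hM.mul_act f g v).symm

theorem IsASModule.polyAct_C (hM : IsASModule M) (c : ℂ) (v : M) : polyAct M (C c) v = c • v := by
  rw [← mul_one (C c), ← smul_eq_C_mul, map_smul]
  exact congrArg (c • ·) (hM.one_act v)

variable (M) in
/-- The operator `∂ᵢ - aᵢ`. -/
def shiftedPartial (a : Fin 2 → ℂ) (i : Fin 2) : Module.End ℂ M :=
  LieModule.toEnd ℂ SBar M (partialS i) - a i • 1

theorem shiftedPartial_apply (a : Fin 2 → ℂ) (i : Fin 2) (v : M) :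
    shiftedPartial M a i v = ⁅partialS i, v⁆ - a i • v := rfl

theorem shiftedPartial_lie (a : Fin 2 → ℂ) (i : Fin 2) (D : SBar) (v : M) :
    shiftedPartial M a i ⁅D, v⁆ = ⁅⁅partialS i, D⁆, v⁆ + ⁅D, shiftedPartial M a i v⁆ := by
  rw [shiftedPartial_apply, shiftedPartial_apply, leibniz_lie, lie_sub, lie_smul]
  abel

theorem shiftedPartial_polyAct (a : Fin 2 → ℂ) (i : Fin 2) (f : A₂) (v : M) :
    shiftedPartial M a i (polyAct M f v)
      = polyAct M (pderiv i f) v + polyAct M f (shiftedPartial M a i v) := by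
  rw [shiftedPartial_apply, shiftedPartial_apply, lie_polyAct, map_sub, map_smul, coe_partialS]
  abel

theorem IsASModule.isNilpotentWeyl (hM : IsASModule M) (a : Fin 2 → ℂ)
    (h : ∀ i (v : M), ∃ n : ℕ, (shiftedPartial M a i ^ n) v = 0) :
    IsNilpotentWeyl (shiftedPartial M a) (fun i => polyAct M (X i)) where
  d_t i x := by
    rw [shiftedPartial_polyAct, pderiv_X_self, ← C_1, hM.polyAct_C, one_smul, add_comm]
  d_t_ne i j x hij := by
    rw [shiftedPartial_polyAct, pderiv_X_of_ne hij.symm, map_zero, LinearMap.zero_apply, zero_add]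
  d_d i j x := by
    rw [shiftedPartial_apply a j, map_sub, map_smul, shiftedPartial_lie, partialS_lie, zero_lie,
      zero_add, shiftedPartial_apply a j]
  t_t i j x := by rw [← hM.polyAct_mul, ← hM.polyAct_mul, mul_comm]
  nil := h

theorem IsOfType.exists_shiftedPartial_pow {a : Fin 2 → ℂ} (hM : IsOfType M a) (i : Fin 2) (v : M) :
    ∃ n : ℕ, (shiftedPartial M a i ^ n) v = 0 := by
  obtain ⟨n, hn⟩ := hM v ⟨partialS i, partialS_mem i⟩
  rw [phi_partialS] at hn
  exact ⟨n, hn⟩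

theorem mem_Wh_iff {a : Fin 2 → ℂ} {v : M} : v ∈ Wh M a ↔ ∀ i, shiftedPartial M a i v = 0 := by
  constructor
  · intro h i
    have := h ⟨partialS i, partialS_mem i⟩
    rw [phi_partialS] at this
    exact sub_eq_zero.mpr this
  · intro h x
    obtain ⟨c, hc⟩ := (Submodule.mem_span_range_iff_exists_fun ℂ).mp x.2
    have hx : x = ∑ i, c i • (⟨partialS i, partialS_mem i⟩ : Delta) :=
      Subtype.ext (by rw [← hc]; simp [Fin.sum_univ_two])
    have hi : ∀ i, ⁅partialS i, v⁆ = a i • v := fun i => sub_eq_zero.mp (h i)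
    have e : deltaEnd M x v = ⁅(x : SBar), v⁆ := rfl
    have hp : phi a x = c 0 * a 0 + c 1 * a 1 := by
      rw [hx, Fin.sum_univ_two, map_add, map_smul, map_smul, phi_partialS,
        phi_partialS, smul_eq_mul, smul_eq_mul]
    rw [e, ← hc, hp, Fin.sum_univ_two, add_lie, smul_lie, smul_lie, hi, hi]
    module

variable (M) in
/-- The subspace `𝔪 M`, where `𝔪` is the maximal ideal of the origin. -/
def originSubmodule : LieSubmodule ℂ vanishing M where
  toSubmodule := Submodule.span ℂ {w | ∃ f v, constantCoeff f = 0 ∧ w = polyAct M f v}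
  lie_mem {D w} hw := by
    induction hw using Submodule.span_induction with
    | mem w hw =>
      obtain ⟨f, v, hf, rfl⟩ := hw
      -- In `D (f v) = (D f) v + f (D v)` the polynomial `D f` vanishes at the origin because `D`
      -- does.
      rw [LieSubalgebra.coe_bracket_of_module, lie_polyAct]
      exact Submodule.add_mem _
        (Submodule.subset_span ⟨_, _, constantCoeff_vanishing_apply D f, rfl⟩)
        (Submodule.subset_span ⟨_, _, hf, rfl⟩)
    | zero => rw [lie_zero]; exact Submodule.zero_mem _
    | add v w _ _ hv hw => rw [lie_add]; exact Submodule.add_mem _ hv hw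
    | smul c v _ hv => rw [lie_smul]; exact Submodule.smul_mem _ c hv

theorem polyAct_mem_originSubmodule {f : A₂} (hf : constantCoeff f = 0) (v : M) :
    polyAct M f v ∈ originSubmodule M := Submodule.subset_span ⟨f, v, hf, rfl⟩

theorem IsASModule.exists_of_mem_originSubmodule (hM : IsASModule M) {w : M}
    (hw : w ∈ originSubmodule M) :
    ∃ y z, w = polyAct M (X 0) y + polyAct M (X 1) z := by
  change w ∈ Submodule.span ℂ _ at hw
  induction hw using Submodule.span_induction with
  | mem w hw =>
    obtain ⟨f, v, hf, rfl⟩ := hw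
    obtain ⟨g, h, e⟩ := exists_eq_C_add f
    refine ⟨polyAct M g v, polyAct M h v, ?_⟩
    rw [← hM.polyAct_mul, ← hM.polyAct_mul, ← LinearMap.add_apply, ← map_add]
    rw [hf, C_0, zero_add] at e
    rw [← e]
  | zero => exact ⟨0, 0, by simp⟩
  | add v w _ _ hv hw =>
    obtain ⟨y, z, rfl⟩ := hv
    obtain ⟨y', z', rfl⟩ := hw
    exact ⟨y + y', z + z', by rw [map_add, map_add]; abel⟩
  | smul c v _ hv =>
    obtain ⟨y, z, rfl⟩ := hv
    exact ⟨c • y, c • z, by rw [map_smul, map_smul, smul_add]⟩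

variable (M) in
/-- The fibre `M / 𝔪 M` of `M` at the origin. -/
abbrev OriginFiber : Type u := M ⧸ originSubmodule M

variable (M) in
/-- The projection of `M` to its fibre at the origin. -/
abbrev toFiber : M →ₗ⁅ℂ, vanishing⁆ OriginFiber M := LieSubmodule.Quotient.mk' (originSubmodule M)

instance : LieRingModule gl₂ (OriginFiber M) :=
  LieRingModule.compLieHom (OriginFiber M) linearFieldHom

instance : LieModule ℂ gl₂ (OriginFiber M) := LieModule.compLieHom (OriginFiber M) linearFieldHom

theorem gl_lie_fiber (G : gl₂) (q : OriginFiber M) : ⁅G, q⁆ = ⁅linearFieldHom G, q⁆ := rfl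

theorem IsASModule.toFiber_polyAct (hM : IsASModule M) (f : A₂) (v : M) :
    toFiber M (polyAct M f v) = constantCoeff f • toFiber M v := by
  rw [← map_smul, ← sub_eq_zero, ← map_sub, ← hM.polyAct_C, ← LinearMap.sub_apply, ← map_sub,
    LieSubmodule.Quotient.mk_eq_zero]
  exact polyAct_mem_originSubmodule (by simp) v

variable (M) in
/-- The vectors of the fibre which are killed by the fields without constant and linear terms. -/
def higherInvariants : LieSubmodule ℂ gl₂ (OriginFiber M) where
  carrier := {q | ∀ x ∈ higher, ⁅x, q⁆ = 0}
  add_mem' {q r} hq hr x hx := by rw [lie_add, hq x hx, hr x hx, add_zero]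
  zero_mem' x _ := lie_zero x
  smul_mem' c q hq x hx := by rw [lie_smul, hq x hx, smul_zero]
  lie_mem {G q} hq x hx := by
    rw [gl_lie_fiber, leibniz_lie, hq x hx, lie_zero, add_zero]
    exact hq _ (lie_mem_higher _ hx)

variable {a : Fin 2 → ℂ}

/-- This is the decomposition `M = Wh_a(M) ⊕ 𝔪M` supplied by the Weyl algebra. -/
theorem IsASModule.toFiber_Wh_bijective (hM : IsASModule M) (ht : IsOfType M a) :
    Function.Bijective ((toFiber M : M →ₗ[ℂ] OriginFiber M) ∘ₗ (Wh M a).subtype) := by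
  have hw := hM.isNilpotentWeyl a ht.exists_shiftedPartial_pow
  constructor
  · rw [injective_iff_map_eq_zero]
    rintro ⟨w, h⟩ h0
    obtain ⟨y, z, e⟩ := hM.exists_of_mem_originSubmodule 
      ((LieSubmodule.Quotient.mk_eq_zero _).mp h0)
    exact Subtype.ext (hw.eq_zero_of_eq_add (mem_Wh_iff.mp h) e)
  · intro q
    obtain ⟨v, rfl⟩ := LieSubmodule.Quotient.surjective_mk' _ q
    obtain ⟨w, h, y, z, rfl⟩ := hw.exists_add v
    refine ⟨⟨w, mem_Wh_iff.mpr h⟩, ?_⟩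
    change toFiber M w = toFiber M _
    rw [map_add, map_add, hM.toFiber_polyAct, hM.toFiber_polyAct]
    simp

/-- The inverse of the isomorphism of the Whittaker vectors with the fibre at the origin. -/
def IsASModule.whSection (hM : IsASModule M) (ht : IsOfType M a) : OriginFiber M →ₗ[ℂ] M :=
  (Wh M a).subtype ∘ₗ (LinearEquiv.ofBijective _ (hM.toFiber_Wh_bijective ht)).symm.toLinearMap

theorem IsASModule.toFiber_whSection (hM : IsASModule M) (ht : IsOfType M a) (q : OriginFiber M) :
    toFiber M (hM.whSection ht q) = q :=
  (LinearEquiv.ofBijective _ (hM.toFiber_Wh_bijective ht)).apply_symm_apply q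

theorem IsASModule.shiftedPartial_whSection (hM : IsASModule M) (ht : IsOfType M a)
    (q : OriginFiber M) (i : Fin 2) : shiftedPartial M a i (hM.whSection ht q) = 0 :=
  mem_Wh_iff.mp (Subtype.prop _) i

/-- Split `D` into its constant part, acting on `v` through `a`, its linear part, acting through
`gl₂`, and a remainder in `higher`, acting by zero. The result is the formula for `T(A₂ᵃ, V)`
evaluated at the origin. -/
theorem toFiber_lie {v : M}
    (hv : ∀ i, shiftedPartial M a i v = 0) (hq : toFiber M v ∈ higherInvariants M) (D : SBar) :
    toFiber M ⁅D, v⁆ = (∑ i, a i * constantCoeff ((D : W₂) (X i))) • toFiber M v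
      + ⁅linearPart (D : W₂), toFiber M v⁆ := by
  set c : Fin 2 → ℂ := fun i => constantCoeff ((D : W₂) (X i)) with hc
  let D₀ : vanishing := ⟨D - ∑ i, c i • partialS i, fun i => by
    fin_cases i <;> simp [Fin.sum_univ_two, coe_partialS, pderiv_X, hc, smul_eq_C_mul]⟩
  have hD : D = (D₀ : SBar) + ∑ i, c i • partialS i := (sub_add_cancel _ _).symm
  have hlin : linearPart ((D₀ : SBar) : W₂) = linearPart (D : W₂) := by
    ext j i
    fin_cases i <;> simp [D₀, linearPart, Fin.sum_univ_two, coe_partialS, pderiv_X]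
  have h0 := hq _ (sub_linearFieldHom_mem_higher D₀)
  rw [sub_lie, sub_eq_zero, hlin, ← gl_lie_fiber] at h0
  have hi : ∀ i, ⁅partialS i, v⁆ = a i • v := fun i => sub_eq_zero.mp (hv i)
  conv_lhs => rw [hD]
  rw [← h0, add_lie, map_add, ← LieSubalgebra.coe_bracket_of_module, LieModuleHom.map_lie]
  simp only [Fin.sum_univ_two, add_lie, smul_lie, hi, map_add, map_smul]
  module

end Modules

/-! ### The modules `T(A₂ᵃ, V)` as Weyl algebra representations -/

section Tensor

variable (a : Fin 2 → ℂ) (V : Type u) [AddCommGroup V] [Module ℂ V]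

/-- The pure tensors in `T(A₂ᵃ, V)`. -/
def pureT : A₂ →ₗ[ℂ] V →ₗ[ℂ] T a V := TensorProduct.mk ℂ A₂ V

variable {a V}

theorem T_induction {p : T a V → Prop} (zero : p 0) (add : ∀ x y, p x → p y → p (x + y))
    (tmul : ∀ f v, p (pureT a V f v)) (x : T a V) : p x :=
  TensorProduct.induction_on (motive := p) x zero tmul add

variable [LieRingModule gl₂ V] [LieModule ℂ gl₂ V]

theorem polyAct_pureT (f g : A₂) (v : V) :
    polyAct (T a V) f (pureT a V g v) = pureT a V (f * g) v := by
  change tensorAct V a (ofA f) (g ⊗ₜ v) = (f * g) ⊗ₜ v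
  simp [tensorAct]

theorem lie_pureT (D : SBar) (g : A₂) (v : V) :
    ⁅D, pureT a V g v⁆ = pureT a V (twistedAct a (D : W₂) g) v
      + ∑ j, ∑ i, pureT a V (jacobian (D : W₂) j i * g) ⁅(Matrix.single j i 1 : gl₂), v⁆ := by
  have h : tensorAct V a (ofS D) (g ⊗ₜ v)
      = twistedAct a (D : W₂) g ⊗ₜ v + matAct V (jacobian (D : W₂)) (g ⊗ₜ v) := by
    simp [tensorAct]
  rw [matAct_tmul] at h
  exact h

theorem isASModule_T : IsASModule (T a V) where
  mul_act f g w := by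
    change polyAct (T a V) f (polyAct (T a V) g w) = polyAct (T a V) (f * g) w
    induction w using T_induction with
    | zero => simp only [map_zero]
    | add x y hx hy => simp only [map_add, hx, hy]
    | tmul p v => simp only [polyAct_pureT, mul_assoc]
  one_act w := by
    change polyAct (T a V) 1 w = w
    induction w using T_induction with
    | zero => simp only [map_zero]
    | add x y hx hy => simp only [map_add, hx, hy]
    | tmul p v => rw [polyAct_pureT, one_mul]

/-- A constant field has zero Jacobian, and the shift by `a i` cancels the twist. -/
theorem shiftedPartial_pureT (i : Fin 2) (g : A₂) (v : V) :
    shiftedPartial (T a V) a i (pureT a V g v) = pureT a V (pderiv i g) v := by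
  have hj : jacobian (partialS i : W₂) = 0 := by
    ext j k : 2
    simp [jacobian, coe_partialS, pderiv_X, Pi.single_apply, apply_ite]
  have ht : twistedAct a (partialS i : W₂) g = pderiv i g + a i • g := by
    fin_cases i <;> simp [twistedAct, coe_partialS, Fin.sum_univ_two, pderiv_X]
  rw [shiftedPartial_apply, lie_pureT, hj, ht]
  simp

theorem exists_shiftedPartial_T_pow (i : Fin 2) (w : T a V) :
    ∃ n : ℕ, (shiftedPartial (T a V) a i ^ n) w = 0 := by
  induction w using T_induction with
  | zero => exact ⟨0, map_zero _⟩
  | add x y hx hy =>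
    obtain ⟨m, hm⟩ := hx
    obtain ⟨n, hn⟩ := hy
    refine ⟨n + m, ?_⟩
    rw [map_add, pow_add, Module.End.mul_apply, hm, map_zero, zero_add, ← pow_add, add_comm n m,
      pow_add, Module.End.mul_apply, hn, map_zero]
  | tmul p v =>
    have h : ∀ n : ℕ, (shiftedPartial (T a V) a i ^ n) (pureT a V p v)
        = pureT a V (((pderiv i : W₂).toLinearMap ^ n) p) v := fun n => by
      induction n with
      | zero => rfl
      | succ n ih =>
        rw [pow_succ', Module.End.mul_apply, ih, shiftedPartial_pureT, pow_succ',
          Module.End.mul_apply]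
        rfl
    obtain ⟨n, hn⟩ := exists_pderiv_pow_eq_zero i p
    exact ⟨n, by rw [h, hn, map_zero, LinearMap.zero_apply]⟩

/-- Modulo `𝔪`, `w` agrees with some `1 ⊗ v`; the difference is a Whittaker vector in the `𝔪`-part,
hence zero. -/
theorem exists_eq_pureT_one {w : T a V} (hw : ∀ i, shiftedPartial (T a V) a i w = 0) :
    ∃ v, w = pureT a V 1 v := by
  have h : ∀ w : T a V, ∃ v y z, w = pureT a V 1 v
      + (polyAct (T a V) (X 0) y + polyAct (T a V) (X 1) z) := fun w => by
    induction w using T_induction with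
    | zero => exact ⟨0, 0, 0, by simp⟩
    | add x x' hx hx' =>
      obtain ⟨v, y, z, rfl⟩ := hx
      obtain ⟨v', y', z', rfl⟩ := hx'
      exact ⟨v + v', y + y', z + z', by simp only [map_add]; abel⟩
    | tmul p v =>
      obtain ⟨g, h, e⟩ := exists_eq_C_add p
      refine ⟨constantCoeff p • v, pureT a V g v, pureT a V h v, ?_⟩
      rw [polyAct_pureT, polyAct_pureT, ← LinearMap.add_apply, ← map_add, map_smul,
        ← LinearMap.smul_apply, ← map_smul, ← LinearMap.add_apply, ← map_add, smul_eq_C_mul,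
        mul_one, ← add_assoc, ← e]
  obtain ⟨v, y, z, e⟩ := h w
  refine ⟨v, sub_eq_zero.mp ?_⟩
  refine (isASModule_T.isNilpotentWeyl a exists_shiftedPartial_T_pow).eq_zero_of_eq_add
    (y := y) (z := z) (fun i => ?_) (sub_eq_iff_eq_add'.mpr e)
  rw [map_sub, hw, shiftedPartial_pureT, pderiv_one, map_zero, LinearMap.zero_apply, sub_zero]

end Tensor

/-! ### The comparison map `T(A₂ᵃ, V) → M` -/

section Comparison

variable {M : Type u} [AddCommGroup M] [Module ℂ M] [LieRingModule STilde M] [LieModule ℂ STilde M]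
  {a : Fin 2 → ℂ} (hM : IsASModule M) (ht : IsOfType M a)
  {V : Type u} [AddCommGroup V] [Module ℂ V] [LieRingModule gl₂ V] [LieModule ℂ gl₂ V]
  (ι : V →ₗ⁅ℂ, gl₂⁆ OriginFiber M)

/-- The `A₂`-linear map `T(A₂ᵃ, V) → M` given on `V` by the section of the fibre at the origin. -/
def comparison : T a V →ₗ[ℂ] M :=
  (TensorProduct.lift ((LinearMap.lcomp ℂ M (hM.whSection ht ∘ₗ (ι : V →ₗ[ℂ] OriginFiber M))) ∘ₗ
    polyAct M) : A₂ ⊗[ℂ] V →ₗ[ℂ] M)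

theorem comparison_pureT (p : A₂) (v : V) :
    comparison hM ht ι (pureT a V p v) = polyAct M p (hM.whSection ht (ι v)) :=
  TensorProduct.lift.tmul p v

theorem comparison_pureT_one (v : V) :
    comparison hM ht ι (pureT a V 1 v) = hM.whSection ht (ι v) := by
  rw [comparison_pureT, ← C_1, hM.polyAct_C, one_smul]

theorem comparison_polyAct (f : A₂) (w : T a V) :
    comparison hM ht ι (polyAct (T a V) f w) = polyAct M f (comparison hM ht ι w) := by
  induction w using T_induction with
  | zero => simp only [map_zero]
  | add x y hx hy => simp only [map_add, hx, hy]
  | tmul p v => rw [polyAct_pureT, comparison_pureT, comparison_pureT, hM.polyAct_mul]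

theorem comparison_shiftedPartial (i : Fin 2) (w : T a V) :
    comparison hM ht ι (shiftedPartial (T a V) a i w)
      = shiftedPartial M a i (comparison hM ht ι w) := by
  induction w using T_induction with
  | zero => simp only [map_zero]
  | add x y hx hy => simp only [map_add, hx, hy]
  | tmul p v =>
    rw [shiftedPartial_pureT, comparison_pureT, comparison_pureT, shiftedPartial_polyAct,
      hM.shiftedPartial_whSection, map_zero, add_zero]

theorem toFiber_comparison_lie (D : SBar) (v : V) :
    toFiber M (comparison hM ht ι ⁅D, pureT a V 1 v⁆)
      = (∑ i, a i * constantCoeff ((D : W₂) (X i))) • ι v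
        + ⁅linearPart (D : W₂), ι v⁆ := by
  have h1 : constantCoeff (twistedAct a (D : W₂) 1)
      = ∑ i, a i * constantCoeff ((D : W₂) (X i)) := by
    simp [twistedAct, Fin.sum_univ_two]
  have h2 : linearPart (D : W₂) = ∑ j, ∑ i,
      constantCoeff (jacobian (D : W₂) j i) • (Matrix.single j i 1 : gl₂) := by
    conv_lhs => rw [Matrix.matrix_eq_sum_single (linearPart (D : W₂))]
    simp [Matrix.smul_single, jacobian, linearPart]
  rw [lie_pureT, map_add, map_add, comparison_pureT, hM.toFiber_polyAct, hM.toFiber_whSection, h1,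
    h2]
  congr 1
  simp only [Fin.sum_univ_two, map_add, comparison_pureT, hM.toFiber_polyAct, mul_one,
    hM.toFiber_whSection, add_lie, smul_lie, LieModuleHom.map_lie]

variable {ι}

/-- The two sides agree only in the fibre a priori, where `toFiber_lie` and `toFiber_comparison_lie`
give the same formula. Letting `D` vary makes the span of the differences stable under the `∂ᵢ -
aᵢ`, and a stable subspace of `𝔪M` is zero since it contains no nonzero Whittaker vector. -/
theorem comparison_lie_pureT_one (hι : ∀ v, ι v ∈ higherInvariants M) (D : SBar) (v : V) :
    comparison hM ht ι ⁅D, pureT a V 1 v⁆ = ⁅D, hM.whSection ht (ι v)⁆ := by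
  have hw := hM.isNilpotentWeyl a ht.exists_shiftedPartial_pow
  let N : Submodule ℂ M := Submodule.span ℂ {w | ∃ (D : SBar) (v : V),
    w = comparison hM ht ι ⁅D, pureT a V 1 v⁆ - ⁅D, hM.whSection ht (ι v)⁆}
  have hN0 : N ≤ originSubmodule M := by
    refine Submodule.span_le.mpr ?_
    rintro _ ⟨D, v, rfl⟩
    refine (LieSubmodule.Quotient.mk_eq_zero _).mp ?_
    have hs := toFiber_lie (hM.shiftedPartial_whSection ht (ι v))
      (by rw [hM.toFiber_whSection]; exact hι v) D
    rw [map_sub, toFiber_comparison_lie, hs, hM.toFiber_whSection, sub_self]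
  have hN1 : ∀ i, ∀ x ∈ N, shiftedPartial M a i x ∈ N := by
    intro i x hx
    induction hx using Submodule.span_induction with
    | mem x hx =>
      obtain ⟨D, v, rfl⟩ := hx
      -- Both `1 ⊗ v` and its image are Whittaker vectors, so `∂ᵢ - aᵢ` takes the difference for `D`
      -- to the one for `[∂ᵢ, D]`.
      refine Submodule.subset_span ⟨⁅partialS i, D⁆, v, ?_⟩
      rw [map_sub, ← comparison_shiftedPartial, shiftedPartial_lie, shiftedPartial_lie,
        shiftedPartial_pureT, pderiv_one, map_zero, LinearMap.zero_apply,
        hM.shiftedPartial_whSection, lie_zero, lie_zero, add_zero, add_zero]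
    | zero => rw [map_zero]; exact N.zero_mem
    | add x y _ _ hx hy => rw [map_add]; exact N.add_mem hx hy
    | smul c x _ hx => rw [map_smul]; exact N.smul_mem c hx
  have hN : N = ⊥ := by
    by_contra h
    obtain ⟨w, hw1, hw2, hw3⟩ := hw.exists_mem_ker N hN1 h
    obtain ⟨y, z, e⟩ := hM.exists_of_mem_originSubmodule (hN0 hw1)
    exact hw2 (hw.eq_zero_of_eq_add hw3 e)
  have : comparison hM ht ι ⁅D, pureT a V 1 v⁆ - ⁅D, hM.whSection ht (ι v)⁆ ∈ N :=
    Submodule.subset_span ⟨D, v, rfl⟩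
  rwa [hN, Submodule.mem_bot, sub_eq_zero] at this

/-- The Leibniz rule and `A₂`-linearity reduce equivariance to the generators `1 ⊗ v`. -/
theorem comparison_lie (hι : ∀ v, ι v ∈ higherInvariants M) (x : STilde) (w : T a V) :
    comparison hM ht ι ⁅x, w⁆ = ⁅x, comparison hM ht ι w⁆ := by
  rw [stilde_lie_eq, stilde_lie_eq, map_add, comparison_polyAct, add_right_inj]
  induction w using T_induction with
  | zero => rw [lie_zero, map_zero, lie_zero]
  | add x y hx hy => rw [lie_add, map_add, map_add, lie_add, hx, hy]
  | tmul p v =>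
    have h : pureT a V p v = polyAct (T a V) p (pureT a V 1 v) := by rw [polyAct_pureT, mul_one]
    rw [h, lie_polyAct, map_add, comparison_polyAct, comparison_polyAct, comparison_polyAct,
      lie_polyAct, comparison_lie_pureT_one hM ht hι, comparison_pureT_one]

/-- `comparison` as a homomorphism of `S̃₂`-modules. -/
def comparisonHom (hι : ∀ v, ι v ∈ higherInvariants M) : T a V →ₗ⁅ℂ, STilde⁆ M :=
  { comparison hM ht ι with map_lie' := comparison_lie hM ht hι _ _ }

theorem whSection_injective : Function.Injective (hM.whSection ht) :=
  Function.LeftInverse.injective (hM.toFiber_whSection ht)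

/-- A nonzero kernel, being stable under the `∂ᵢ - aᵢ`, contains a nonzero Whittaker vector `1 ⊗ v`;
but on these the map is an injective section composed with `ι`. -/
theorem comparison_injective (hi : Function.Injective ι) :
    Function.Injective (comparison hM ht ι) := by
  rw [← LinearMap.ker_eq_bot]
  by_contra h
  obtain ⟨w, hw, hw0, hw1⟩ := (isASModule_T.isNilpotentWeyl a
    exists_shiftedPartial_T_pow).exists_mem_ker _ (fun i x hx => by
      rw [LinearMap.mem_ker] at hx ⊢
      rw [comparison_shiftedPartial, hx, map_zero]) h
  obtain ⟨v, rfl⟩ := exists_eq_pureT_one hw1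
  rw [LinearMap.mem_ker, comparison_pureT_one] at hw
  have hv : v = 0 := hi (whSection_injective hM ht (by rw [hw, map_zero, map_zero]))
  exact hw0 (by rw [hv, map_zero])

theorem comparison_surjective [LieModule.IsIrreducible ℂ STilde M] [Nontrivial V]
    (hι : ∀ v, ι v ∈ higherInvariants M) (hi : Function.Injective ι) :
    Function.Surjective (comparison hM ht ι) := by
  obtain ⟨v, hv⟩ := exists_ne (0 : V)
  have h : (comparisonHom hM ht hι).range = ⊤ := by
    refine (IsSimpleOrder.eq_bot_or_eq_top _).resolve_left fun h => hv ?_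
    have h1 : comparison hM ht ι (pureT a V 1 v) ∈ (comparisonHom hM ht hι).range :=
      (LieModuleHom.mem_range _ _).mpr ⟨_, rfl⟩
    rw [h, LieSubmodule.mem_bot, comparison_pureT_one] at h1
    exact hi (whSection_injective hM ht (by rw [h1, map_zero, map_zero]))
  exact (LieModuleHom.range_eq_top _).mp h

/-- A simple module `M` is isomorphic to `T(A₂ᵃ, V)` for every nonzero submodule `V` of the
invariants in its fibre at the origin. -/
def comparisonEquiv [LieModule.IsIrreducible ℂ STilde M] [Nontrivial V]
    (hι : ∀ v, ι v ∈ higherInvariants M) (hi : Function.Injective ι) :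
    T a V ≃ₗ⁅ℂ, STilde⁆ M :=
  { comparisonHom hM ht hι, LinearEquiv.ofBijective (comparison hM ht ι)
    ⟨comparison_injective hM ht hi, comparison_surjective hM ht hι hi⟩ with }

end Comparison

theorem isIrreducible_of_isAtom {Q : Type u} [AddCommGroup Q] [Module ℂ Q] [LieRingModule gl₂ Q]
    [LieModule ℂ gl₂ Q] {U : LieSubmodule ℂ gl₂ Q} (hU : IsAtom U) :
    LieModule.IsIrreducible ℂ gl₂ U := by
  have : Nontrivial U := (LieSubmodule.nontrivial_iff_ne_bot ℂ gl₂ Q).mpr hU.1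
  refine LieModule.IsIrreducible.mk fun N hN => ?_
  have hle : N.map U.incl ≤ U := LieSubmodule.map_incl_le
  rcases hU.le_iff.mp hle with h | h
  · refine absurd ?_ hN
    rw [eq_bot_iff]
    intro x hx
    have : (x : Q) ∈ N.map U.incl := LieSubmodule.mem_map_of_mem hx
    rw [h, LieSubmodule.mem_bot] at this
    exact Subtype.ext this
  · rw [eq_top_iff]
    intro x _
    have : (x : Q) ∈ N.map U.incl := by rw [h]; exact x.2
    obtain ⟨y, hy, e⟩ := (LieSubmodule.mem_map _).mp this
    rwa [← Subtype.ext e]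

end CartanS

end

theorem corollary3 (a : Fin 2 → ℂ) (M : Type u)
    [AddCommGroup M] [Module ℂ M] [LieRingModule CartanS.STilde M] [LieModule ℂ CartanS.STilde M]
    (hAS : CartanS.IsASModule M)
    (hsimple : LieModule.IsIrreducible ℂ CartanS.STilde M)
    (hWhittaker : CartanS.IsWhittaker M)
    (htype : CartanS.IsOfType M a)
    (hfin : FiniteDimensional ℂ (CartanS.Wh M a)) :
    ∃ (V : Type u) (_ : AddCommGroup V) (_ : Module ℂ V)
      (_ : LieRingModule CartanS.gl₂ V) (_ : LieModule ℂ CartanS.gl₂ V),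
      FiniteDimensional ℂ V ∧ LieModule.IsIrreducible ℂ CartanS.gl₂ V ∧
        Nonempty (M ≃ₗ⁅ℂ, CartanS.STilde⁆ CartanS.T a V) := by
  open CartanS in
  let e := LinearEquiv.ofBijective _ (hAS.toFiber_Wh_bijective htype)
  have : Nontrivial M := LieModule.nontrivial_of_isIrreducible ℂ STilde M
  have hfib : FiniteDimensional ℂ (OriginFiber M) := e.finiteDimensional
  -- A nonzero Whittaker vector makes the fibre nonzero.
  obtain ⟨w, -, hw0, hw⟩ := (hAS.isNilpotentWeyl a htype.exists_shiftedPartial_pow).exists_mem_ker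
    ⊤ (fun _ _ _ => Submodule.mem_top) top_ne_bot
  have : Nontrivial (Wh M a) :=
    ⟨⟨w, mem_Wh_iff.mpr hw⟩, 0, fun h => hw0 (congrArg Subtype.val h)⟩
  have : Nontrivial (OriginFiber M) := e.symm.toEquiv.nontrivial
  obtain ⟨q, hq0, hq⟩ := exists_ne_zero_forall_higher_lie (OriginFiber M)
  have hne : higherInvariants M ≠ ⊥ := fun h => hq0 (by
    have : q ∈ higherInvariants M := hq
    rwa [h, LieSubmodule.mem_bot] at this)
  -- Minimal nonzero submodules exist because the fibre is finite-dimensional.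
  obtain ⟨U, hU, hle⟩ := (eq_bot_or_exists_atom_le (higherInvariants M)).resolve_left hne
  have hirr := isIrreducible_of_isAtom hU
  have : Nontrivial U := LieModule.nontrivial_of_isIrreducible ℂ gl₂ U
  exact ⟨U, inferInstance, inferInstance, inferInstance, inferInstance, inferInstance, hirr,
    ⟨(comparisonEquiv hAS htype (ι := U.incl) (fun v => hle v.2) U.injective_incl).symm⟩⟩
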